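/- Let $X$ be a compactum (a compact metrizable space), and let $K(X)$ be the space of compact subsets of $X$ with the Vietoris topology. A $\sigma$-ideal of compact sets in $X$ is a collection $I\subseteq K(X)$ that is closed under taking compact subsets and contains every compact set which is the union of countably many elements of $I$; it is coanalytic if $K(X)\setminus I$ is analytic, and thin if there is no uncountable family of pairwise disjoint compact subsets of $X$ which are not in $I$. A $\sigma$-ideal on $X$ is a collection $J$ of Borel subsets of $X$ that is closed under taking Borel subsets and countable unions and satisfies $X\notin J$. For $I\subseteq K(X)$ let $\tilde I_{Bor(X)}$ be the collection of all Borel sets $B\subseteq X$ such that every compact subset of $B$ belongs to $I$. A $G_{\delta\sigma}$-set is a countable union of $G_\delta$-sets. **Theorem 3.2.** Let $I$ be a coanalytic $\sigma$-ideal of compact sets in a compactum $X$. If $\tilde I_{Bor(X)}$ is a $\sigma$-ideal on $X$ containing all singletons, then the following are equivalent: (a) $I$ is thin; (b) if $J\supseteq\tilde I_{Bor(X)}$ is any $\sigma$-ideal on $X$, then every set in $J$ is contained in a $G_\delta$-set belonging to $J$. Moreover, if $I$ is not thin, then there is a $G_{\delta\sigma}$-set $M$ in $X$ such that: (i) there is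 no $G_\delta$-set $G$ in $X$ containing $M$ with $G\setminus M\in\tilde I_{Bor(X)}$; (ii) there is a $\sigma$-ideal $I'\supseteq\tilde I_{Bor(X)}$ on $X$ such that $M\in I'$ but $M$ is not contained in any $G_\delta$-set belonging to $I'$. -/

import Mathlib

open TopologicalSpace MeasureTheory

namespace ThinIdeals

/-- `K(X)` is Mathlib's `Compacts X` with the Vietoris topology (the empty set is a point of it).
A subset of `K(X)` is coanalytic if its complement is analytic. -/
def IsCoanalytic {X : Type*} [TopologicalSpace X] (I : Set (Compacts X)) : Prop :=
  AnalyticSet Iᶜ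

/-- A σ-ideal of compact sets: a collection of compact sets closed under compact subsets, and such
that a compact set which is the union of countably many members is again a member. -/
structure IsCompactSigmaIdeal {X : Type*} [TopologicalSpace X] (I : Set (Compacts X)) : Prop where
  hereditary : ∀ K ∈ I, ∀ L : Compacts X, L ≤ K → L ∈ I
  countable_union : ∀ S : Set (Compacts X), S.Countable → S ⊆ I →
    ∀ K : Compacts X, (K : Set X) = ⋃ L ∈ S, (L : Set X) → K ∈ I

/-- A (proper) σ-ideal on `X`: a collection of Borel sets closed under Borel subsets and countable
unions, and not containing the whole space. -/
structure IsBorelSigmaIdeal {X : Type*} [MeasurableSpace X] (J : Set (Set X)) : Prop where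
  measurableSet : ∀ B ∈ J, MeasurableSet B
  hereditary : ∀ B ∈ J, ∀ A : Set X, MeasurableSet A → A ⊆ B → A ∈ J
  countable_union : ∀ S : Set (Set X), S.Countable → S ⊆ J → ⋃₀ S ∈ J
  univ_notMem : Set.univ ∉ J

/-- The collection of all Borel sets all of whose compact subsets belong to `I`. -/
def borelHull {X : Type*} [TopologicalSpace X] [MeasurableSpace X] (I : Set (Compacts X)) :
    Set (Set X) :=
  {B | MeasurableSet B ∧ ∀ K : Compacts X, (K : Set X) ⊆ B → K ∈ I}

/-- `I` is thin if there is no uncountable family of pairwise disjoint compact sets not in `I`. -/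
def IsThin {X : Type*} [TopologicalSpace X] (I : Set (Compacts X)) : Prop :=
  ¬ ∃ A : Set (Compacts X), ¬ A.Countable ∧ (∀ K ∈ A, K ∉ I) ∧
    A.Pairwise (fun K L => Disjoint (K : Set X) (L : Set X))

/-- A `G_{δσ}`-set: a countable union of `G_δ`-sets. -/
def IsGdeltaSigma {X : Type*} [TopologicalSpace X] (M : Set X) : Prop :=
  ∃ f : ℕ → Set X, (∀ n, IsGδ (f n)) ∧ M = ⋃ n, f n

end ThinIdeals

open Set Filter Topology

/-! If `I` is thin, a maximal disjoint family of compact sets outside `I` and missing `B` is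
countable. The complement of its union is a `G_δ` containing `B`, and by maximality what it adds to
`B` lies in the hull, hence in `J`. If `I` is not thin, coanalyticity turns an uncountable disjoint
family into a continuous Cantor family `φ` (`exists_continuous_clique`). Let `M` be the union of `φ`
over a countable dense set of indices. A `G_δ` containing `M` contains `φ t` for comeagre many `t`,
so by Baire it contains some `φ t` disjoint from `M`. Adjoining `M` to the hull gives `I'`. -/

/-- The points of a set all of whose neighbourhoods meet it in an uncountable set. -/
def condensationPoints {Y : Type*} [TopologicalSpace Y] (C : Set Y) : Set Y :=
  {x ∈ C | ∀ U : Set Y, IsOpen U → x ∈ U → ¬ (U ∩ C).Countable}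

theorem countable_diff_condensationPoints {Y : Type*} [TopologicalSpace Y]
    [SecondCountableTopology Y] (C : Set Y) : (C \ condensationPoints C).Countable := by
  have hsub : C \ condensationPoints C ⊆
      ⋃ o ∈ {o ∈ TopologicalSpace.countableBasis Y | (o ∩ C).Countable}, o ∩ C := by
    rintro x ⟨hxC, hx⟩
    simp only [condensationPoints, mem_ofPred_eq, not_and, not_forall, not_not] at hx
    obtain ⟨U, hU, hxU, hc⟩ := hx hxC
    obtain ⟨o, ho, hxo, hoU⟩ :=
      (TopologicalSpace.isBasis_countableBasis Y).exists_subset_of_mem_open hxU hU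
    exact mem_biUnion (show o ∈ {o ∈ TopologicalSpace.countableBasis Y | (o ∩ C).Countable} from
      ⟨ho, hc.mono (inter_subset_inter_left C hoU)⟩) ⟨hxo, hxC⟩
  refine Countable.mono hsub (Countable.biUnion ?_ fun o ho => ho.2)
  exact (TopologicalSpace.countable_countableBasis Y).mono fun o ho => ho.1

/-- Only countably many points of `C` are not condensation points, so an uncountable `U ∩ C` retains
others besides `x`. -/
theorem exists_ne_mem_condensationPoints {Y : Type*} [TopologicalSpace Y]
    [SecondCountableTopology Y] {C : Set Y} {x : Y} (hx : x ∈ condensationPoints C)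
    {U : Set Y} (hU : IsOpen U) (hxU : x ∈ U) :
    ∃ y ∈ condensationPoints C, y ∈ U ∧ x ≠ y := by
  by_contra! h
  refine hx.2 U hU hxU (((countable_diff_condensationPoints C).union
    (countable_singleton x)).mono ?_)
  rintro y ⟨hyU, hyC⟩
  by_cases hy : y ∈ condensationPoints C
  · exact Or.inr (h y hy hyU).symm
  · exact Or.inl ⟨hyC, hy⟩

/-- If an open relation on a Polish space has an uncountable clique, it has a clique which is a
continuous image of the Cantor space. -/
theorem exists_continuous_clique {Y : Type*} [TopologicalSpace Y] [PolishSpace Y]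
    {R : Set (Y × Y)} (hR : IsOpen R) {C : Set Y} (hC : ¬ C.Countable)
    (hCR : ∀ x ∈ C, ∀ y ∈ C, x ≠ y → (x, y) ∈ R) :
    ∃ g : (ℕ → Bool) → Y, Continuous g ∧ ∀ s t, s ≠ t → (g s, g t) ∈ R := by
  let _ := TopologicalSpace.upgradeIsCompletelyMetrizable Y
  have hne : (condensationPoints C).Nonempty := by
    by_contra h
    refine hC ((countable_diff_condensationPoints C).mono ?_)
    rw [not_nonempty_iff_eq_empty.1 h, sdiff_empty]
  let P := {p : Y × ℝ // p.1 ∈ condensationPoints C ∧ 0 < p.2}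
  have split : ∀ p : P, ∃ q : Bool → P,
      (∀ b, Metric.closedBall (q b).1.1 (q b).1.2 ⊆ Metric.closedBall p.1.1 p.1.2) ∧
      (∀ b, (q b).1.2 ≤ p.1.2 / 2) ∧
      ∀ a b, a ≠ b → Metric.closedBall (q a).1.1 (q a).1.2 ×ˢ
        Metric.closedBall (q b).1.1 (q b).1.2 ⊆ R := by
    rintro ⟨⟨x, r⟩, hx, hr⟩
    dsimp only at hx hr ⊢
    obtain ⟨y, hy, hyU, hxy⟩ := exists_ne_mem_condensationPoints hx Metric.isOpen_ball
      (Metric.mem_ball_self hr)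
    have hball : Metric.closedBall x r ∈ 𝓝 y :=
      mem_of_superset (Metric.isOpen_ball.mem_nhds hyU) Metric.ball_subset_closedBall
    have hsym : ∀ᶠ ε : ℝ in 𝓝[>] 0, Metric.closedBall x ε ×ˢ Metric.closedBall y ε ⊆ R ∧
        Metric.closedBall y ε ×ˢ Metric.closedBall x ε ⊆ R := by
      have key : ∀ u v : Y, (u, v) ∈ R →
          ∀ᶠ ε : ℝ in 𝓝[>] 0, Metric.closedBall u ε ×ˢ Metric.closedBall v ε ⊆ R := by
        intro u v huv
        obtain ⟨ε, hε, hsub⟩ := Metric.nhds_basis_closedBall.mem_iff.1 (hR.mem_nhds huv)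
        filter_upwards [Ioc_mem_nhdsGT hε] with δ hδ
        rw [closedBall_prod_same]
        exact (Metric.closedBall_subset_closedBall hδ.2).trans hsub
      exact (key x y (hCR x hx.1 y hy.1 hxy)).and (key y x (hCR y hy.1 x hx.1 hxy.symm))
    obtain ⟨δ, hδ, hδsub⟩ := Metric.nhds_basis_closedBall.mem_iff.1 hball
    -- One radius serves both children: `ε ≤ δ` keeps the ball at `y` inside the parent, and `ε ≤ r
    -- / 2` makes the diameters vanish.
    obtain ⟨ε, ⟨h₁, h₂⟩, ⟨hε, hεδ⟩, -, hεr⟩ := (hsym.and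
      ((eventually_mem_set.2 (Ioc_mem_nhdsGT hδ)).and
        (eventually_mem_set.2 (Ioc_mem_nhdsGT (half_pos hr))))).exists
    refine ⟨fun b => bif b then ⟨(x, ε), hx, hε⟩ else ⟨(y, ε), hy, hε⟩, ?_, ?_, ?_⟩
    · rintro (_ | _)
      · exact (Metric.closedBall_subset_closedBall hεδ).trans hδsub
      · exact Metric.closedBall_subset_closedBall (by simp only [cond_true]; linarith)
    · rintro (_ | _) <;> exact hεr
    · rintro (_ | _) (_ | _) hab
      · exact absurd rfl hab
      · exact h₂
      · exact h₁
      · exact absurd rfl hab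
  choose q hq_sub hq_half hq_R using split
  obtain ⟨x₀, hx₀⟩ := hne
  -- `PiNat.res` puts the newest bit at the head, so `cons` passes to a child.
  let D : List Bool → P := fun l => l.rec ⟨(x₀, 1), hx₀, one_pos⟩ fun b _ p => q p b
  let A : List Bool → Set Y := fun l => Metric.closedBall (D l).1.1 (D l).1.2
  have hanti : CantorScheme.ClosureAntitone A :=
    CantorScheme.Antitone.closureAntitone (fun l b => hq_sub (D l) b)
      fun l => Metric.isClosed_closedBall
  have hrad : ∀ (x : ℕ → Bool) (n : ℕ), (D (PiNat.res x n)).1.2 ≤ (1 / 2) ^ n := by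
    intro x n
    induction n with
    | zero => simp [D]
    | succ n ih =>
      refine (hq_half (D (PiNat.res x n)) (x n)).trans ?_
      rw [pow_succ]
      linarith
  have hdiam : CantorScheme.VanishingDiam A := by
    intro x
    have hlim : Tendsto (fun n : ℕ => ENNReal.ofReal (2 * (1 / 2) ^ n)) atTop (𝓝 0) := by
      have := (tendsto_pow_atTop_nhds_zero_of_lt_one (r := (1 / 2 : ℝ)) (by norm_num)
        (by norm_num)).const_mul 2
      simpa using ENNReal.tendsto_ofReal this
    refine tendsto_of_tendsto_of_tendsto_of_le_of_le tendsto_const_nhds hlim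
      (fun _ => zero_le) fun n => Metric.ediam_le fun y hy z hz => ?_
    rw [edist_dist]
    refine ENNReal.ofReal_le_ofReal ((dist_triangle_right y z (D (PiNat.res x n)).1.1).trans ?_)
    have hy' : dist y _ ≤ _ := hy
    have hz' : dist z _ ≤ _ := hz
    linarith [hrad x n]
  have hdom : ∀ x : ℕ → Bool, x ∈ (CantorScheme.inducedMap A).1 := fun x => by
    rw [hanti.map_of_vanishingDiam hdiam fun l =>
      ⟨_, Metric.mem_closedBall_self (D l).2.2.le⟩]
    exact mem_univ x
  refine ⟨fun x => (CantorScheme.inducedMap A).2 ⟨x, hdom x⟩,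
    hdiam.map_continuous.comp (by fun_prop), fun s t hst => ?_⟩
  -- At the first difference the branches enter sibling balls, whose product lies in `R`.
  have hres : PiNat.res s (PiNat.firstDiff s t) = PiNat.res t (PiNat.firstDiff s t) :=
    PiNat.res_eq_res.2 fun _ hm => PiNat.apply_eq_of_lt_firstDiff hm
  have hs := CantorScheme.map_mem (A := A) ⟨s, hdom s⟩ (PiNat.firstDiff s t + 1)
  have ht := CantorScheme.map_mem (A := A) ⟨t, hdom t⟩ (PiNat.firstDiff s t + 1)
  rw [PiNat.res_succ] at hs ht
  dsimp only at hs ht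
  rw [← hres] at ht
  exact hq_R _ _ _ (PiNat.apply_firstDiff_ne hst) ⟨hs, ht⟩

theorem dense_compl_singleton_cantor (q : ℕ → Bool) : Dense ({q}ᶜ : Set (ℕ → Bool)) := by
  rw [dense_compl_singleton_iff_not_open]
  intro h
  have hlim : Tendsto (fun n => Function.update q n (!q n)) atTop (𝓝 q) := by
    refine tendsto_pi_nhds.2 fun i => tendsto_const_nhds.congr' ?_
    filter_upwards [eventually_gt_atTop i] with n hn
    rw [Function.update_of_ne hn.ne]
  obtain ⟨n, hn⟩ := (hlim.eventually (h.mem_nhds (mem_singleton q))).exists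
  simpa using congrFun (mem_singleton_iff.1 hn) n

namespace ThinIdeals

/-- A coanalytic non-thin collection misses a Cantor family of pairwise disjoint compact sets. -/
theorem exists_cantor_family {X : Type*} [TopologicalSpace X] [T2Space X]
    {I : Set (Compacts X)} (hcoan : IsCoanalytic I) (hthin : ¬ IsThin I) :
    ∃ φ : (ℕ → Bool) → Compacts X, Continuous φ ∧ (∀ t, φ t ∉ I) ∧
      ∀ s t, s ≠ t → Disjoint (φ s : Set X) (φ t) := by
  obtain ⟨A, hA, hAI, hdisj⟩ := not_not.1 hthin
  rw [IsCoanalytic, AnalyticSet] at hcoan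
  rcases hcoan with hempty | ⟨f, hf, hrange⟩
  · refine absurd ?_ hA
    rw [eq_empty_of_forall_notMem fun K hK => (hempty ▸ hAI K hK : K ∈ (∅ : Set (Compacts X)))]
    exact countable_empty
  have hpre : ∀ K ∈ A, ∃ y, f y = K := fun K hK => by
    have : K ∈ range f := hrange ▸ hAI K hK
    exact this
  choose! e he using hpre
  have hC : ¬ (e '' A).Countable := fun h => hA <| by
    exact (h.image f).mono fun K hK => (he K hK) ▸ mem_image_of_mem f (mem_image_of_mem e hK)
  -- Disjointness is Vietoris-open, so it pulls back along `f` to an open relation on Baire space.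
  obtain ⟨g, hg, hgR⟩ := exists_continuous_clique
    (R := {p : (ℕ → ℕ) × (ℕ → ℕ) | Disjoint (f p.1 : Set X) (f p.2)})
    (Compacts.isOpen_setOfPred_disjoint_coe.preimage (hf.prodMap hf)) hC (by
      rintro _ ⟨K, hK, rfl⟩ _ ⟨L, hL, rfl⟩ hne
      change Disjoint (f (e K) : Set X) (f (e L))
      rw [he K hK, he L hL]
      exact hdisj hK hL fun h => hne (congrArg e h))
  refine ⟨f ∘ g, hf.comp hg, fun t => ?_, hgR⟩
  have : f (g t) ∈ Iᶜ := hrange ▸ mem_range_self (g t)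
  exact this

/-- The union of a countable dense part of a Cantor family of disjoint compact sets outside `I` is
not contained in a `G_δ`-set up to a set in the hull of `I`. -/
theorem exists_isGdeltaSigma_not_gdelta {X : Type*} [TopologicalSpace X] [MetrizableSpace X]
    [MeasurableSpace X] {I : Set (Compacts X)} {φ : (ℕ → Bool) → Compacts X}
    (hφ : Continuous φ) (hφI : ∀ t, φ t ∉ I)
    (hdisj : ∀ s t, s ≠ t → Disjoint (φ s : Set X) (φ t)) :
    ∃ M : Set X, IsGdeltaSigma M ∧
      ¬ ∃ G : Set X, IsGδ G ∧ M ⊆ G ∧ G \ M ∈ borelHull I := by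
  let _ := metrizableSpaceMetric X
  let Q := denseSeq (ℕ → Bool)
  refine ⟨⋃ n, φ (Q n), ⟨fun n => φ (Q n), fun n => (φ (Q n)).isCompact.isClosed.isGδ, rfl⟩, ?_⟩
  rintro ⟨G, hG, hMG, hdiff⟩
  obtain ⟨U, hU, rfl⟩ := isGδ_iff_eq_iInter_nat.1 hG
  have hopen : ∀ n, IsOpen {t | (φ t : Set X) ⊆ U n} := fun n =>
    (Compacts.isOpen_subsets_of_isOpen (hU n)).preimage hφ
  have hdense : ∀ n, Dense {t | (φ t : Set X) ⊆ U n} := fun n =>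
    (denseRange_denseSeq (ℕ → Bool)).mono <| range_subset_iff.2 fun k =>
      (subset_iUnion (fun n => (φ (Q n) : Set X)) k).trans (hMG.trans (iInter_subset U n))
  -- Excluding each `Q n` as well makes `φ t` disjoint from `M`.
  obtain ⟨t, ht⟩ := (dense_iInter_of_isOpen (fun n => (hopen n).inter isOpen_compl_singleton)
    fun n => (hdense n).inter_of_isOpen_left (dense_compl_singleton_cantor (Q n))
      (hopen n)).nonempty
  rw [mem_iInter] at ht
  refine hφI t (hdiff.2 (φ t) (subset_sdiff.2 ⟨subset_iInter fun n => (ht n).1, ?_⟩))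
  exact disjoint_iUnion_right.2 fun n => hdisj _ _ (ht n).2

theorem IsBorelSigmaIdeal.union_mem {X : Type*} [MeasurableSpace X] {J : Set (Set X)}
    (hJ : IsBorelSigmaIdeal J) {A B : Set X} (hA : A ∈ J) (hB : B ∈ J) : A ∪ B ∈ J := by
  rw [← sUnion_pair]
  exact hJ.countable_union _ (by simp) (pair_subset hA hB)

/-- Adjoining a Borel set to a σ-ideal which does not contain its complement. -/
theorem IsBorelSigmaIdeal.adjoin {X : Type*} [MeasurableSpace X] {J : Set (Set X)}
    (hJ : IsBorelSigmaIdeal J) {M : Set X} (hM : MeasurableSet M) (hMJ : Mᶜ ∉ J) :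
    IsBorelSigmaIdeal {B | MeasurableSet B ∧ B \ M ∈ J} where
  measurableSet _ hB := hB.1
  hereditary B hB A hA hAB :=
    ⟨hA, hJ.hereditary _ hB.2 _ (hA.diff hM) (sdiff_subset_sdiff_left hAB)⟩
  countable_union S hS hSJ := by
    refine ⟨MeasurableSet.sUnion hS fun B hB => (hSJ hB).1, ?_⟩
    have : ⋃₀ S \ M = ⋃₀ ((· \ M) '' S) := by
      rw [sUnion_image, sUnion_eq_biUnion]
      simp only [sdiff_eq, iUnion_inter]
    rw [this]
    exact hJ.countable_union _ (hS.image _) (image_subset_iff.2 fun B hB => (hSJ hB).2)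
  univ_notMem h := hMJ (compl_eq_univ_sdiff M ▸ h.2)

theorem IsThin.exists_isGδ {X : Type*} [TopologicalSpace X] [T2Space X]
    [MeasurableSpace X] [BorelSpace X] {I : Set (Compacts X)} (hthin : IsThin I)
    (hbot : ⊥ ∈ I) {J : Set (Set X)} (hJ : IsBorelSigmaIdeal J) (hIJ : borelHull I ⊆ J)
    {B : Set X} (hB : B ∈ J) : ∃ G ∈ J, IsGδ G ∧ B ⊆ G := by
  let F : Set (Set (Compacts X)) := {A | (∀ K ∈ A, K ∉ I ∧ Disjoint (K : Set X) B) ∧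
    A.Pairwise fun K L => Disjoint (K : Set X) (L : Set X)}
  obtain ⟨A, hA⟩ := zorn_subset F fun c hcF hc => by
    refine ⟨⋃₀ c, ⟨?_, (pairwise_sUnion hc.directedOn).2 fun A hA => (hcF hA).2⟩,
      fun A hA => subset_sUnion_of_mem hA⟩
    rintro K ⟨A, hA, hKA⟩
    exact (hcF hA).1 K hKA
  have hcount : A.Countable := by
    by_contra h
    exact hthin ⟨A, h, fun K hK => (hA.prop.1 K hK).1, hA.prop.2⟩
  have hGδ : IsGδ (⋂ K ∈ A, (K : Set X)ᶜ) :=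
    IsGδ.biInter hcount fun K _ => K.isCompact.isClosed.isOpen_compl.isGδ
  have hBG : B ⊆ ⋂ K ∈ A, (K : Set X)ᶜ :=
    subset_iInter₂ fun K hK => ((hA.prop.1 K hK).2).subset_compl_left
  refine ⟨_, ?_, hGδ, hBG⟩
  rw [← union_sdiff_cancel hBG]
  refine hJ.union_mem hB (hIJ ⟨hGδ.measurableSet.diff (hJ.measurableSet B hB), fun K hK => ?_⟩)
  by_contra hKI
  have hKB : Disjoint (K : Set X) B := (subset_sdiff.1 hK).2
  have hKA : ∀ L ∈ A, Disjoint (K : Set X) (L : Set X) := fun L hL =>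
    subset_compl_iff_disjoint_right.1 ((subset_sdiff.1 hK).1.trans (biInter_subset_of_mem hL))
  have hins : insert K A ∈ F := by
    refine ⟨forall_mem_insert.2 ⟨⟨hKI, hKB⟩, hA.prop.1⟩, ?_⟩
    exact hA.prop.2.insert fun L hL _ => ⟨hKA L hL, (hKA L hL).symm⟩
  -- Maximality puts `K` in `A`, so `K` is disjoint from itself, hence empty.
  have hmem : K ∈ A := hA.le_of_ge hins (subset_insert K A) (mem_insert K A)
  have : K = ⊥ := Compacts.ext (disjoint_self.1 (hKA K hmem))
  exact hKI (this ▸ hbot)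

end ThinIdeals

theorem theorem3p2 {X : Type*} [TopologicalSpace X] [CompactSpace X] [MetrizableSpace X]
    [MeasurableSpace X] [BorelSpace X] (I : Set (Compacts X))
    (hI : ThinIdeals.IsCompactSigmaIdeal I) (hcoan : ThinIdeals.IsCoanalytic I)
    (hhull : ThinIdeals.IsBorelSigmaIdeal (ThinIdeals.borelHull I))
    (hsing : ∀ x : X, {x} ∈ ThinIdeals.borelHull I) :
    (ThinIdeals.IsThin I ↔
      ∀ J : Set (Set X), ThinIdeals.IsBorelSigmaIdeal J → ThinIdeals.borelHull I ⊆ J →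
        ∀ B ∈ J, ∃ G ∈ J, IsGδ G ∧ B ⊆ G) ∧
    (¬ ThinIdeals.IsThin I →
      ∃ M : Set X, ThinIdeals.IsGdeltaSigma M ∧
        (¬ ∃ G : Set X, IsGδ G ∧ M ⊆ G ∧ G \ M ∈ ThinIdeals.borelHull I) ∧
        ∃ I' : Set (Set X), ThinIdeals.IsBorelSigmaIdeal I' ∧ ThinIdeals.borelHull I ⊆ I' ∧
          M ∈ I' ∧ ¬ ∃ G ∈ I', IsGδ G ∧ M ⊆ G) := by
  have hbot : ⊥ ∈ I := hI.countable_union ∅ countable_empty (empty_subset I) ⊥ (by simp)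
  have hnot : ¬ ThinIdeals.IsThin I →
      ∃ M : Set X, ThinIdeals.IsGdeltaSigma M ∧
        (¬ ∃ G : Set X, IsGδ G ∧ M ⊆ G ∧ G \ M ∈ ThinIdeals.borelHull I) ∧
        ∃ I' : Set (Set X), ThinIdeals.IsBorelSigmaIdeal I' ∧ ThinIdeals.borelHull I ⊆ I' ∧
          M ∈ I' ∧ ¬ ∃ G ∈ I', IsGδ G ∧ M ⊆ G := by
    intro hthin
    obtain ⟨φ, hφ, hφI, hdisj⟩ := ThinIdeals.exists_cantor_family hcoan hthin
    obtain ⟨M, hM, hMG⟩ := ThinIdeals.exists_isGdeltaSigma_not_gdelta hφ hφI hdisj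
    have hMm : MeasurableSet M := by
      obtain ⟨f, hf, rfl⟩ := hM
      exact MeasurableSet.iUnion fun n => (hf n).measurableSet
    -- `I'` is proper: were `Mᶜ` in the hull, `G = univ` would contradict `hMG`.
    refine ⟨M, hM, hMG, _, hhull.adjoin hMm fun h =>
      hMG ⟨univ, .univ, subset_univ M, compl_eq_univ_sdiff M ▸ h⟩, fun B hB => ?_, ?_, ?_⟩
    · exact ⟨hB.1, hhull.hereditary B hB _ (hB.1.diff hMm) sdiff_subset⟩
    · exact ⟨hMm, hhull.hereditary _ (ThinIdeals.IsBorelSigmaIdeal.countable_union hhull ∅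
        countable_empty (empty_subset _)) _ (hMm.diff hMm) (by simp)⟩
    · rintro ⟨G, hG, hGδ, hsub⟩
      exact hMG ⟨G, hGδ, hsub, hG.2⟩
  refine ⟨⟨fun hthin J hJ hIJ B hB => hthin.exists_isGδ hbot hJ hIJ hB, fun h => ?_⟩, hnot⟩
  by_contra hthin
  obtain ⟨M, -, -, I', hI', hsub, hMI', hMG⟩ := hnot hthin
  exact hMG (h I' hI' hsub M hMI')
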